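/- Let $K$ be a compact connected metric space and let $F_1,\dots,F_N:K\to K$ be injective contractions with $K=\bigcup_i F_i(K)$ (for an attractor $K\subset\mathbb R^d$ of an iterated function system, the $F_i$ are the restrictions of its maps to $K$). For a word $w=w_1\cdots w_k$ put $F_w=F_{w_1}\circ\cdots\circ F_{w_k}$; the sets $K_w=F_w(K)$ with $|w|=k$ are the $k$-cells. Let $\mathcal C=\bigcup_{i\ne j}F_i(K)\cap F_j(K)$, $V_0=\bigcup_{|w|\ge1}F_w^{-1}(\mathcal C)\subset K$ and $V_{k+1}=\bigcup_iF_i(V_k)$. Assume that $\mathcal C\neq\emptyset$ and that $V_0$ is finite ($K$ is a p.c.f. fractal). Let a harmonic structure be given: symmetric conductances $c^k_{xy}\ge0$ ($x\ne y\in V_k$, $k\ge0$) such that the forms $\mathcal E_k(u)=\frac12\sum_{x,y\in V_k}c^k_{xy}(u(y)-u(x))^2$ vanish only on constants, and numbers $0<r_1,\dots,r_N<1$, with $$\mathcal E_{k+1}(u)=\sum_{j=1}^N\frac1{r_j}\mathcal E_k(u\circ F_j),\qquad \mathcal E_k(v)=\min\{\mathcal E_{k+1}(u): u\in\mathbb R^{V_{k+1}},\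 u|_{V_k}=v\}\qquad(k\ge0).$$ Let $\Gamma_k$ be the graph on $V_k$ with $x\sim_k y$ iff $x\neq y$ and $c^k_{xy}>0$. Below, a cycle is a simple closed path with a chosen orientation and base point, and $V(\gamma)$ is the set of vertices of a cycle $\gamma$. Let $\mathbb T=\mathbb R/\mathbb Z$. A continuous $g:\mathbb T\to\mathbb T$ has a lift, a continuous $G:\mathbb R\to\mathbb R$ with $G(t)\bmod1=g(t\bmod 1)$, and its degree is $G(1)-G(0)$. For $a\in\mathbb T$ let $\langle a\rangle\in(-\frac12,\frac12]$ be its representative. A harmonic map is a continuous $f:K\to\mathbb T$ such that $\sup_k\frac12\sum_{x,y\in V_k}c^k_{xy}\langle f(y)-f(x)\rangle^2<\infty$ and such that, for all sufficiently large $k$, $$\sum_{y\in V_k}c^k_{xy}\langle f(y)-f(x)\rangle=0\qquad\text{for all }x\in V_k\setminus V_0 .$$ Fix a level $m\ge0$ and cycles $\gamma_1,\dots,\gamma_n$ of $\Gamma_m$ forming a basis of its cycle space (over $\mathbb Z/2$), and assume that there are cycles $\iota(\gamma_i)$ of $\Gamma_{m+1}$ and points $\xi_i\in V_{m+1}$ with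 1. $V(\gamma_i)\subset V(\iota(\gamma_i))$ for all $i$; 2. $V(\iota(\gamma_i))\cap V(\iota(\gamma_j))=V(\gamma_i)\cap V(\gamma_j)$ for $i\neq j$; 3. $\xi_i\in V(\iota(\gamma_i))$ and $\xi_i\notin V(\iota(\gamma_j))$ for $j\ne i$. For each $i$ let $c_i:\mathbb T\to K$ be a loop tracing $\iota(\gamma_i)$: it starts at the base point, visits the vertices of $\iota(\gamma_i)$ in their order, and travels between consecutive vertices inside an assigned $(m+1)$-cell (given by a word of length $m+1$). Assume that $\xi_i$ has two itineraries along this cycle, that is, the words assigned to the two edges of $\iota(\gamma_i)$ meeting at $\xi_i$ are different. Let $\gamma_0$ be a cycle of $\Gamma_m$ with $V_0\subset V(\gamma_0)$, and let $c_0:\mathbb T\to K$ be a loop in $K$ passing through all vertices of $\gamma_0$. Let $V_0=\{v_1,\dots,v_\ell\}$ (distinct points) and let $t_1<t_2<\dots<t_\ell<t_1+1$ be real numbers with $c_0(t_k\bmod 1)=v_k$. Then for all $\rho_1,\dots,\rho_n\in\mathbb Z$ and all $\delta_1,\dots,\delta_{\ell-1}\in\mathbb R$ there is a harmonic map $f:K\to\mathbb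 T$ such that $f\circ c_i$ has degree $\rho_i$ for $i=1,\dots,n$, and such that, with $\rho_0$ the degree of $f\circ c_0$, some lift $\bar f$ of $f\circ c_0$ satisfies $$\bar f(t_{k+1})-\bar f(t_k)=\delta_k\quad(1\le k\le\ell-1),\qquad \bar f(t_1+1)-\bar f(t_\ell)=\rho_0-\delta_1-\dots-\delta_{\ell-1}.$$ -/

import Mathlib

noncomputable section

/-! ### Post-critically finite self-similar sets -/

section Words

variable {K : Type*} {N : ℕ}

/-- The map `F_w = F_{w₁} ∘ F_{w₂} ∘ ⋯ ∘ F_{w_m}` of a word `w = w₁ w₂ ⋯ w_m`. -/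
def wordMap (F : Fin N → K → K) : List (Fin N) → K → K
  | [] => id
  | i :: w => F i ∘ wordMap F w

/-- The critical set, the union of all `F_i(K) ∩ F_j(K)` with `i ≠ j`. -/
def criticalSet (F : Fin N → K → K) : Set K :=
  {x | ∃ i j : Fin N, i ≠ j ∧ x ∈ Set.range (F i) ∧ x ∈ Set.range (F j)}

/-- The boundary `V₀`: the union of `F_w⁻¹(C)` over all nonempty words `w`, where `C` is the
critical set. -/
def boundarySet (F : Fin N → K → K) : Set K :=
  {p | ∃ w : List (Fin N), w ≠ [] ∧ wordMap F w p ∈ criticalSet F}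

/-- The vertex sets `V_m`, with `V_{m+1} = ⋃ i, F_i(V_m)`. -/
def vertexSet (F : Fin N → K → K) : ℕ → Set K
  | 0 => boundarySet F
  | m + 1 => ⋃ i, F i '' vertexSet F m

end Words

/-- A p.c.f. self-similar structure with `N` maps on the metric space `K`: `K` is the union of the
images of the injective contractions `F_i`, the critical set is nonempty, and the boundary `V₀` is
finite.  (Compactness and connectedness of `K` are separate type class assumptions.  If `K` is given
as a subset of an ambient space, then `F_i` here is the restriction of the `i`-th map to `K`.) -/
structure PCFFractal (K : Type*) [MetricSpace K] (N : ℕ) where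
  F : Fin N → K → K
  contracting : ∀ i, ∃ l : NNReal, l < 1 ∧ LipschitzWith l (F i)
  injective : ∀ i, Function.Injective (F i)
  cover : ⋃ i, Set.range (F i) = Set.univ
  critical_nonempty : (criticalSet F).Nonempty
  finite_boundary : (boundarySet F).Finite

namespace PCFFractal

variable {K : Type*} [MetricSpace K] {N : ℕ} (S : PCFFractal K N)

/-- The vertex set `V_m`. -/
def V (m : ℕ) : Set K := vertexSet S.F m

theorem finite_V (m : ℕ) : (S.V m).Finite := by
  induction m with
  | zero => exact S.finite_boundary
  | succ m ih => exact Set.finite_iUnion fun i => ih.image (S.F i)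

/-- `V_m` as a finset. -/
def verts (m : ℕ) : Finset K := (S.finite_V m).toFinset

/-- The cell `K_w = F_w(K)`. -/
def cell (w : List (Fin N)) : Set K := Set.range (wordMap S.F w)

/-- The quadratic form `(1/2) ∑_{x, y ∈ V_m} c_{xy} (u(y) - u(x))²`. -/
def energy (m : ℕ) (c : K → K → ℝ) (u : K → ℝ) : ℝ :=
  (1 / 2) * ∑ x ∈ S.verts m, ∑ y ∈ S.verts m, c x y * (u y - u x) ^ 2

end PCFFractal

/-! ### Harmonic structures and approximating graphs -/

/-- A harmonic structure: conductances `c^m` on each `V_m`, whose energy forms `E_m` vanish only on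
constants and are self-similar and compatible.  Functions on `V_m` are represented by functions on
`K`, of which `E_m` only sees the values on `V_m`. -/
structure HarmonicStructure {K : Type*} [MetricSpace K] {N : ℕ} (S : PCFFractal K N) where
  c : ℕ → K → K → ℝ
  symm : ∀ m, ∀ x ∈ S.V m, ∀ y ∈ S.V m, c m x y = c m y x
  nonneg : ∀ m, ∀ x ∈ S.V m, ∀ y ∈ S.V m, x ≠ y → 0 ≤ c m x y
  definite : ∀ (m : ℕ) (u : K → ℝ), S.energy m (c m) u = 0 →
    ∀ x ∈ S.V m, ∀ y ∈ S.V m, u x = u y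
  r : Fin N → ℝ
  r_pos : ∀ i, 0 < r i
  r_lt_one : ∀ i, r i < 1
  self_similar : ∀ (m : ℕ) (u : K → ℝ),
    S.energy (m + 1) (c (m + 1)) u = ∑ j, (1 / r j) * S.energy m (c m) (u ∘ S.F j)
  compatible : ∀ (m : ℕ) (v : K → ℝ),
    IsLeast {e : ℝ | ∃ u : K → ℝ, (∀ x ∈ S.V m, u x = v x) ∧ e = S.energy (m + 1) (c (m + 1)) u}
      (S.energy m (c m) v)

/-- A (simple, based, oriented) cycle of a graph. -/
structure GraphCycle {V : Type*} (G : SimpleGraph V) where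
  base : V
  walk : G.Walk base base
  isCycle : walk.IsCycle

namespace GraphCycle

variable {V : Type*} {G : SimpleGraph V}

/-- The set `V(γ)` of vertices of a cycle. -/
def verts (γ : GraphCycle G) : Set V := {v | v ∈ γ.walk.support}

/-- The number of edges of a cycle. -/
def length (γ : GraphCycle G) : ℕ := γ.walk.length

/-- The `k`-th vertex of a cycle, `0 ≤ k ≤ γ.length`; the vertices `0` and `γ.length` coincide. -/
def vert (γ : GraphCycle G) (k : ℕ) : V := γ.walk.getVert k

open Classical in
/-- The element of the edge space over `ℤ/2` given by a cycle. -/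
def edgeVector (γ : GraphCycle G) : Sym2 V → ZMod 2 :=
  fun e => if e ∈ γ.walk.edges then 1 else 0

end GraphCycle

/-- The cycle space of a graph: the subspace of the edge space over `ℤ/2` spanned by the cycles. -/
def cycleSpace {V : Type*} (G : SimpleGraph V) : Submodule (ZMod 2) (Sym2 V → ZMod 2) :=
  Submodule.span (ZMod 2) (Set.range fun γ : GraphCycle G => γ.edgeVector)

/-- The cycles `γ_i` form a basis of the cycle space. -/
def IsCycleBasis {V : Type*} {G : SimpleGraph V} {n : ℕ} (γ : Fin n → GraphCycle G) : Prop :=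
  LinearIndependent (ZMod 2) (fun i => (γ i).edgeVector) ∧
    Submodule.span (ZMod 2) (Set.range fun i => (γ i).edgeVector) = cycleSpace G

/-! ### Circle-valued maps: lifts and degrees -/

/-- The representative in `(-1/2, 1/2]` of an element of `ℝ/ℤ`. -/
def circleRep (t : UnitAddCircle) : ℝ := (AddCircle.equivIoc (1 : ℝ) (-1 / 2) t : ℝ)

/-- `G` is a lift of `g : 𝕋 → 𝕋`: it is continuous and `G(t) = g(t mod 1)` modulo `1`. -/
def IsLift (g : C(UnitAddCircle, UnitAddCircle)) (G : ℝ → ℝ) : Prop :=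
  Continuous G ∧ ∀ t : ℝ, (G t : UnitAddCircle) = g (t : UnitAddCircle)

/-- `g : 𝕋 → 𝕋` has degree `ρ`: a lift `G` satisfies `G(1) - G(0) = ρ`.  (Lifts exist and are
unique up to an additive integer.) -/
def HasDegree (g : C(UnitAddCircle, UnitAddCircle)) (ρ : ℤ) : Prop :=
  ∃ G : ℝ → ℝ, IsLift g G ∧ G 1 - G 0 = ρ

namespace HarmonicStructure

variable {K : Type*} [MetricSpace K] {N : ℕ} {S : PCFFractal K N} (H : HarmonicStructure S)

/-- The approximating graph `Γ_m` on `V_m`: `x ∼ y` if and only if `c^m_{xy} > 0`.  (As a graph on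
the type `K`, the points outside `V_m` are isolated; they lie on no cycle.) -/
def graph (m : ℕ) : SimpleGraph K where
  Adj x y := x ≠ y ∧ x ∈ S.V m ∧ y ∈ S.V m ∧ 0 < H.c m x y
  symm := ⟨by
    rintro x y ⟨hne, hx, hy, h⟩
    exact ⟨hne.symm, hy, hx, H.symm m x hx y hy ▸ h⟩⟩
  loopless := ⟨fun x h => h.1 rfl⟩

/-- The energy `(1/2) ∑_{x, y ∈ V_m} c^m_{xy} d(f(x), f(y))²` of a circle-valued map, `d` the
geodesic distance of `𝕋`. -/
def circleEnergy (m : ℕ) (f : K → UnitAddCircle) : ℝ :=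
  (1 / 2) * ∑ x ∈ S.verts m, ∑ y ∈ S.verts m, H.c m x y * circleRep (f y - f x) ^ 2

/-- The discrete Laplacian of a circle-valued map at `x ∈ V_m`.  If `f` is continuous and `m` is
large, then `circleRep (f y - f x)`, for `y` adjacent to `x` in `Γ_m`, is the difference `u(y) - u(x)`
for every local real-valued lift `u` of `f` on a cell containing `x` and `y`. -/
def circleLaplacian (m : ℕ) (f : K → UnitAddCircle) (x : K) : ℝ :=
  ∑ y ∈ S.verts m, H.c m x y * circleRep (f y - f x)

/-- A harmonic map `K → 𝕋`: a continuous map of finite energy which solves `Δ f = 0` on `K \ V₀`,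
that is, whose local real-valued lifts are `Γ_m`-harmonic at the points of `V_m \ V₀` for all
sufficiently large `m`. -/
def IsHarmonicMap (f : C(K, UnitAddCircle)) : Prop :=
  BddAbove (Set.range fun m => H.circleEnergy m f) ∧
    ∃ M₀ : ℕ, ∀ m, M₀ ≤ m → ∀ x ∈ S.V m, x ∉ S.V 0 → H.circleLaplacian m f x = 0

/-- The loop `c : 𝕋 → K` traces the cycle `γ` of `Γ_n` through the cells `K_{w 0}, K_{w 1}, …` of
level `n`: it visits the vertices of `γ` in their order, and travels from the `k`-th to the
`(k+1)`-st vertex inside the `n`-cell `K_{w k}`. -/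
def Traces {n : ℕ} (c : C(UnitAddCircle, K)) (γ : GraphCycle (H.graph n))
    (w : ℕ → List (Fin N)) : Prop :=
  ∃ τ : ℕ → ℝ, Monotone τ ∧ τ 0 = 0 ∧ τ γ.length = 1 ∧
    (∀ k ≤ γ.length, c (τ k : UnitAddCircle) = γ.vert k) ∧
    ∀ k < γ.length, (w k).length = n ∧
      ∀ t ∈ Set.Icc (τ k) (τ (k + 1)), c (t : UnitAddCircle) ∈ S.cell (w k)

end HarmonicStructure

end

/-!
Glue a harmonic map from real harmonic functions on the cells of level `m + 1`.  Suppose that for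
every word `w` of length `M = m + 1` a continuous real function `h w` on `K` is given, harmonic off
`V₀`, such that the values of the functions agree modulo `1` at the points where two cells meet.
Cells of the same level meet only in vertices (`PCFFractal.mem_V_zero_of_wordMap_eq`), so the
functions `h w`, transported to the cells, glue to a continuous `f : K → 𝕋`
(`PCFFractal.exists_glue`).  By the self-similarity of the conductances
(`HarmonicStructure.edgeSum_add_level`) the Laplacian of `f` on a fine level splits into fluxes of
the `h w`, which do not depend on the level; hence `f` is harmonic as soon as these fluxes balance at
the vertices of level `M` outside `V₀` (`HarmonicStructure.isHarmonicMap_of_cells`).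

The values on the cells are taken of the form `U + A w` on `V_M`, with a real function `U` and
integer jumps `A w`.  The balance of the fluxes is then a Dirichlet problem for `U` on the finite set
`V_M`, solvable for all jumps and all boundary values because the energy is positive definite on
the functions that vanish on `V₀` (`HarmonicStructure.exists_form_eq`).

The degree of `f` along a loop tracing a cycle is the sum of the jumps met on the way
(`HarmonicStructure.lift_sub_eq_sum_jumps`).  The cut point `ξ i` lies on `ι i` only, and `ι i` enters
and leaves it through different cells, so a jump `ρ i` at `ξ i`, placed in the cell of entry alone,
gives `ι i` the degree `ρ i` and does not affect the other cycles.  Finally, changing the boundary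
values of `U` while keeping the jumps adds to `f` a real function on `K` with prescribed boundary
values (`HarmonicStructure.exists_real_difference`).  This leaves all degrees unchanged and
moves the increments of the lift along `c₀` to the required ones.

The continuous harmonic extension of functions on `V₀` is where `r_i < 1` enters: the energy bounds
the oscillation on the vertices of all levels, with a constant independent of the level
(`HarmonicStructure.exists_abs_sub_le_sqrt_form`), and energy scales down in small cells.
-/

/-! ### Words, cells and vertex sets -/

/-- The words of length `k` in the letters `Fin N`, as a finset. -/
def wordsOfLength (N : ℕ) : ℕ → Finset (List (Fin N))
  | 0 => {[]}
  | k + 1 => ((Finset.univ : Finset (Fin N)) ×ˢ wordsOfLength N k).image fun p => p.1 :: p.2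

theorem mem_wordsOfLength {N k : ℕ} {w : List (Fin N)} :
    w ∈ wordsOfLength N k ↔ w.length = k := by
  induction k generalizing w with
  | zero => simp [wordsOfLength]
  | succ k ih =>
    cases w with
    | nil => simp [wordsOfLength]
    | cons i w => simp [wordsOfLength, ih]

theorem sum_wordsOfLength_succ {N k : ℕ} {A : Type*} [AddCommMonoid A] (g : List (Fin N) → A) :
    ∑ w ∈ wordsOfLength N (k + 1), g w = ∑ i, ∑ w ∈ wordsOfLength N k, g (i :: w) := by
  rw [wordsOfLength, Finset.sum_image, Finset.sum_product]
  rintro ⟨i, w⟩ - ⟨j, w'⟩ - h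
  simpa using h

theorem wordMap_append {K : Type*} {N : ℕ} (F : Fin N → K → K) (u w : List (Fin N)) (x : K) :
    wordMap F (u ++ w) x = wordMap F u (wordMap F w x) := by
  induction u with
  | nil => rfl
  | cons i u ih => simp [wordMap, ih]

namespace PCFFractal

open Filter Topology

variable {K : Type*} [MetricSpace K] {N : ℕ} (S : PCFFractal K N)

theorem continuous_F (i : Fin N) : Continuous (S.F i) := by
  obtain ⟨l, -, hl⟩ := S.contracting i
  exact hl.continuous

theorem exists_F_eq (x : K) : ∃ i y, S.F i y = x := by
  have : x ∈ ⋃ i, Set.range (S.F i) := S.cover ▸ Set.mem_univ x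
  simpa using this

theorem continuous_wordMap (w : List (Fin N)) : Continuous (wordMap S.F w) := by
  induction w with
  | nil => exact continuous_id
  | cons i w ih => exact (S.continuous_F i).comp ih

theorem injective_wordMap (w : List (Fin N)) : Function.Injective (wordMap S.F w) := by
  induction w with
  | nil => exact Function.injective_id
  | cons i w ih => exact (S.injective i).comp ih

theorem exists_wordMap_eq (k : ℕ) (x : K) :
    ∃ (w : List (Fin N)) (y : K), w.length = k ∧ wordMap S.F w y = x := by
  induction k generalizing x with
  | zero => exact ⟨[], x, rfl, rfl⟩
  | succ k ih =>
    obtain ⟨i, y, rfl⟩ := S.exists_F_eq x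
    obtain ⟨w, z, hw, rfl⟩ := ih y
    exact ⟨i :: w, z, by simp [hw], rfl⟩

@[simp]
theorem mem_verts {k : ℕ} {x : K} : x ∈ S.verts k ↔ x ∈ S.V k := by
  simp [verts]

theorem mem_V_succ {k : ℕ} {x : K} : x ∈ S.V (k + 1) ↔ ∃ i, ∃ y ∈ S.V k, S.F i y = x := by
  simp [V, vertexSet]

theorem V_zero_nonempty : (S.V 0).Nonempty := by
  obtain ⟨x, i, j, hij, ⟨p, rfl⟩, hj⟩ := S.critical_nonempty
  exact ⟨p, [i], by simp, i, j, hij, ⟨p, rfl⟩, hj⟩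

theorem V_mono : Monotone S.V := by
  refine monotone_nat_of_le_succ fun k => ?_
  induction k with
  | zero =>
    rintro x ⟨w, hw, hx⟩
    obtain ⟨i, y, rfl⟩ := S.exists_F_eq x
    refine S.mem_V_succ.2 ⟨i, y, ⟨w ++ [i], by simp, ?_⟩, rfl⟩
    rwa [wordMap_append]
  | succ k ih =>
    intro x hx
    obtain ⟨i, y, hy, rfl⟩ := S.mem_V_succ.1 hx
    exact S.mem_V_succ.2 ⟨i, y, ih hy, rfl⟩

theorem F_mem_V_succ {k : ℕ} {i : Fin N} {x : K} : S.F i x ∈ S.V (k + 1) ↔ x ∈ S.V k := by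
  refine ⟨fun h => ?_, fun h => S.mem_V_succ.2 ⟨i, x, h, rfl⟩⟩
  obtain ⟨j, y, hy, hyx⟩ := S.mem_V_succ.1 h
  by_cases hij : i = j
  · subst hij
    exact S.injective i hyx ▸ hy
  · exact S.V_mono (Nat.zero_le k) ⟨[i], by simp, i, j, hij, ⟨x, rfl⟩, ⟨y, hyx⟩⟩

theorem wordMap_mem_V {k : ℕ} {w : List (Fin N)} {x : K} :
    wordMap S.F w x ∈ S.V (k + w.length) ↔ x ∈ S.V k := by
  induction w with
  | nil => rfl
  | cons i w ih => exact S.F_mem_V_succ.trans ih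

/-- Two different cells of the same level meet only in boundary vertices of both. -/
theorem mem_V_zero_of_wordMap_eq {w w' : List (Fin N)} (hlen : w.length = w'.length) (hne : w ≠ w')
    {p q : K} (h : wordMap S.F w p = wordMap S.F w' q) : p ∈ S.V 0 := by
  induction w generalizing w' with
  | nil => simp_all [eq_comm]
  | cons i w ih =>
    cases w' with
    | nil => simp at hlen
    | cons j w' =>
      by_cases hij : i = j
      · subst hij
        exact ih (by simpa using hlen) (by simpa using hne) (S.injective i h)
      · exact ⟨i :: w, by simp, i, j, hij, ⟨_, rfl⟩, ⟨_, h.symm⟩⟩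

/-- The cells of large level are uniformly small. -/
theorem exists_dist_wordMap_lt [CompactSpace K] {ε : ℝ} (hε : 0 < ε) :
    ∃ k₀ : ℕ, ∀ w : List (Fin N), k₀ ≤ w.length → ∀ x y,
      dist (wordMap S.F w x) (wordMap S.F w y) < ε := by
  choose l hl hF using S.contracting
  set L := Finset.univ.sup l
  have hL : L < 1 := (Finset.sup_lt_iff (by simp)).2 fun i _ => hl i
  have hLF : ∀ i, LipschitzWith L (S.F i) := fun i =>
    (hF i).weaken (Finset.le_sup (Finset.mem_univ i))
  have key : ∀ (w : List (Fin N)) (x y : K),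
      dist (wordMap S.F w x) (wordMap S.F w y) ≤
        (L : ℝ) ^ w.length * Metric.diam (Set.univ : Set K) := by
    intro w x y
    induction w with
    | nil =>
      simpa [wordMap] using
        Metric.dist_le_diam_of_mem isCompact_univ.isBounded (Set.mem_univ x) (Set.mem_univ y)
    | cons i w ih =>
      refine ((hLF i).dist_le_mul _ _).trans ?_
      rw [List.length_cons, pow_succ', mul_assoc]
      gcongr
  have hlim : Tendsto (fun k : ℕ => (L : ℝ) ^ k * Metric.diam (Set.univ : Set K)) atTop (𝓝 0) := by
    simpa using (tendsto_pow_atTop_nhds_zero_of_lt_one L.2 (by exact_mod_cast hL)).mul_const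
      (Metric.diam (Set.univ : Set K))
  obtain ⟨k₀, hk₀⟩ := eventually_atTop.1 (hlim.eventually_lt_const hε)
  exact ⟨k₀, fun w hw x y => (key w x y).trans_lt (hk₀ _ hw)⟩

theorem isClosed_cell [CompactSpace K] (w : List (Fin N)) : IsClosed (S.cell w) :=
  (isCompact_range (S.continuous_wordMap w)).isClosed

/-- All points near `x` share a cell of level `k` with `x`. -/
theorem eventually_exists_mem_cell [CompactSpace K] (k : ℕ) (x : K) :
    ∀ᶠ y in 𝓝 x, ∃ w : List (Fin N), w.length = k ∧ x ∈ S.cell w ∧ y ∈ S.cell w := by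
  have h : ∀ᶠ y in 𝓝 x, ∀ w ∈ wordsOfLength N k, x ∉ S.cell w → y ∉ S.cell w := by
    rw [Filter.eventually_all_finset]
    intro w _
    by_cases hx : x ∈ S.cell w
    · simp [hx]
    · filter_upwards [(S.isClosed_cell w).isOpen_compl.mem_nhds hx] with y hy _ using hy
  filter_upwards [h] with y hy
  obtain ⟨w, z, hw, rfl⟩ := S.exists_wordMap_eq k y
  exact ⟨w, hw, by_contra fun hx => hy w (mem_wordsOfLength.2 hw) hx ⟨z, rfl⟩, ⟨z, rfl⟩⟩

/-- The vertices of all levels are dense. -/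
theorem dense_iUnion_V [CompactSpace K] : Dense (⋃ k, S.V k) := by
  refine Metric.dense_iff.2 fun x ε hε => ?_
  obtain ⟨k, hk⟩ := S.exists_dist_wordMap_lt hε
  obtain ⟨w, y, hw, rfl⟩ := S.exists_wordMap_eq k x
  obtain ⟨p, hp⟩ := S.V_zero_nonempty
  exact ⟨wordMap S.F w p, hk w hw.ge _ _, Set.mem_iUnion.2 ⟨_, S.wordMap_mem_V.2 hp⟩⟩

/-- Continuous maps on the cells of level `M`, pulled back to `K`, can be glued if they agree at the
points where two cells meet. -/
theorem exists_glue [CompactSpace K] {X : Type*} [TopologicalSpace X] (M : ℕ)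
    (g : List (Fin N) → C(K, X))
    (hg : ∀ w w', w.length = M → w'.length = M → ∀ p ∈ S.V 0, ∀ q ∈ S.V 0,
      wordMap S.F w p = wordMap S.F w' q → g w p = g w' q) :
    ∃ f : C(K, X), ∀ w, w.length = M → ∀ x, f (wordMap S.F w x) = g w x := by
  choose W Y hW hY using S.exists_wordMap_eq M
  have key : ∀ w, w.length = M → ∀ x, g (W (wordMap S.F w x)) (Y (wordMap S.F w x)) = g w x := by
    intro w hw x
    set y := wordMap S.F w x with hy
    by_cases h : W y = w
    · have := hY y
      rw [h] at this ⊢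
      rw [S.injective_wordMap w this]
    · have hlen := (hW y).trans hw.symm
      exact hg _ _ (hW y) hw _ (S.mem_V_zero_of_wordMap_eq hlen h (hY y)) _
        (S.mem_V_zero_of_wordMap_eq hlen.symm (Ne.symm h) (hY y).symm) (hY y)
  refine ⟨⟨fun x => g (W x) (Y x), continuous_iff_isClosed.2 fun C hC => ?_⟩, key⟩
  have : (fun x => g (W x) (Y x)) ⁻¹' C =
      ⋃ w ∈ wordsOfLength N M, wordMap S.F w '' (g w ⁻¹' C) := by
    ext x
    simp only [Set.mem_preimage, Set.mem_iUnion, Set.mem_image, exists_prop]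
    constructor
    · intro hx
      exact ⟨W x, mem_wordsOfLength.2 (hW x), Y x, hx, hY x⟩
    · rintro ⟨w, hw, y, hy, rfl⟩
      rwa [key w (mem_wordsOfLength.1 hw)]
  rw [this]
  exact Set.Finite.isClosed_biUnion (Finset.finite_toSet _) fun w _ =>
    (S.continuous_wordMap w).isClosedMap _ (hC.preimage (g w).continuous)

end PCFFractal

/-! ### Edge sums and the self-similarity of the conductances -/

namespace HarmonicStructure

variable {K : Type*} [MetricSpace K] {N : ℕ} {S : PCFFractal K N} (H : HarmonicStructure S)

/-- The sum of `c^k_{xy} ψ(x, y)` over all ordered pairs of vertices of level `k`. -/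
noncomputable def edgeSum (k : ℕ) (ψ : K → K → ℝ) : ℝ :=
  ∑ x ∈ S.verts k, ∑ y ∈ S.verts k, H.c k x y * ψ x y

/-- The Dirichlet form of level `k`, the polarization of the energy `E_k`. -/
noncomputable def form (k : ℕ) (u φ : K → ℝ) : ℝ :=
  1 / 2 * H.edgeSum k fun x y => (u y - u x) * (φ y - φ x)

theorem energy_eq_form (k : ℕ) (u : K → ℝ) : S.energy k (H.c k) u = H.form k u u := by
  simp only [PCFFractal.energy, form, edgeSum, sq]

variable {H}

theorem edgeSum_congr {k : ℕ} {ψ ψ' : K → K → ℝ}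
    (h : ∀ x ∈ S.V k, ∀ y ∈ S.V k, ψ x y = ψ' x y) : H.edgeSum k ψ = H.edgeSum k ψ' :=
  Finset.sum_congr rfl fun x hx => Finset.sum_congr rfl fun y hy => by
    rw [h x (S.mem_verts.1 hx) y (S.mem_verts.1 hy)]

theorem edgeSum_nonneg {k : ℕ} {ψ : K → K → ℝ} (hdiag : ∀ x, ψ x x = 0)
    (h : ∀ x y, 0 ≤ ψ x y) : 0 ≤ H.edgeSum k ψ :=
  Finset.sum_nonneg fun x hx => Finset.sum_nonneg fun y hy => by
    by_cases hxy : x = y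
    · simp [hxy, hdiag]
    · exact mul_nonneg (H.nonneg k x (S.mem_verts.1 hx) y (S.mem_verts.1 hy) hxy) (h x y)

variable (H)

theorem edgeSum_add (k : ℕ) (ψ ψ' : K → K → ℝ) :
    H.edgeSum k (fun x y => ψ x y + ψ' x y) = H.edgeSum k ψ + H.edgeSum k ψ' := by
  simp only [edgeSum, mul_add, Finset.sum_add_distrib]

theorem edgeSum_const_mul (k : ℕ) (a : ℝ) (ψ : K → K → ℝ) :
    H.edgeSum k (fun x y => a * ψ x y) = a * H.edgeSum k ψ := by
  simp only [edgeSum, Finset.mul_sum, mul_left_comm]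

theorem edgeSum_swap (k : ℕ) (ψ : K → K → ℝ) :
    H.edgeSum k (fun x y => ψ y x) = H.edgeSum k ψ := by
  rw [edgeSum, Finset.sum_comm]
  refine Finset.sum_congr rfl fun x hx => Finset.sum_congr rfl fun y hy => ?_
  rw [H.symm k x (S.mem_verts.1 hx) y (S.mem_verts.1 hy)]

theorem form_symm (k : ℕ) (u φ : K → ℝ) : H.form k u φ = H.form k φ u := by
  simp only [form, mul_comm]

theorem form_add_left (k : ℕ) (u u' φ : K → ℝ) :
    H.form k (u + u') φ = H.form k u φ + H.form k u' φ := by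
  rw [form, form, form, ← mul_add, ← edgeSum_add]
  congr 1
  refine congrArg _ (funext₂ fun x y => ?_)
  simp only [Pi.add_apply]
  ring

theorem form_smul_left (k : ℕ) (a : ℝ) (u φ : K → ℝ) :
    H.form k (a • u) φ = a * H.form k u φ := by
  rw [form, form, mul_left_comm, ← edgeSum_const_mul H k a]
  congr 1
  refine congrArg _ (funext₂ fun x y => ?_)
  simp only [Pi.smul_apply, smul_eq_mul]
  ring

theorem form_add_right (k : ℕ) (u φ φ' : K → ℝ) :
    H.form k u (φ + φ') = H.form k u φ + H.form k u φ' := by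
  simp only [H.form_symm k u, form_add_left]

theorem form_smul_right (k : ℕ) (a : ℝ) (u φ : K → ℝ) :
    H.form k u (a • φ) = a * H.form k u φ := by
  simp only [H.form_symm k u, form_smul_left]

theorem form_self_nonneg (k : ℕ) (u : K → ℝ) : 0 ≤ H.form k u u :=
  mul_nonneg (by norm_num) (edgeSum_nonneg (by simp) fun _ _ => mul_self_nonneg _)

/-- Summation by parts: the form is minus the pairing of `φ` with the Laplacian of `u`. -/
theorem form_eq_neg_edgeSum (k : ℕ) (u φ : K → ℝ) :
    H.form k u φ = -H.edgeSum k fun x y => φ x * (u y - u x) := by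
  have h := H.edgeSum_swap k fun x y => φ x * (u y - u x)
  have : (fun x y => (u y - u x) * (φ y - φ x)) =
      fun x y => (-1) * (φ y * (u x - u y)) + (-1) * (φ x * (u y - u x)) := by
    ext x y
    ring
  rw [form, this, edgeSum_add, edgeSum_const_mul, edgeSum_const_mul, h]
  ring

open Classical in
/-- Edge sums of functions that vanish on the diagonal are determined by the Dirichlet form:
the product of the increments of two indicator functions is supported on one edge. -/
theorem edgeSum_comp_eq_sum_form (k : ℕ) (A : Finset K) (g : K → K) (hg : ∀ x ∈ S.V k, g x ∈ A)
    {ψ : K → K → ℝ} (hψ : ∀ x, ψ x x = 0) :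
    H.edgeSum k (fun x y => ψ (g x) (g y)) = -∑ a ∈ A, ∑ b ∈ A, ψ a b *
      H.form k (fun x => if g x = a then 1 else 0) (fun x => if g x = b then 1 else 0) := by
  have hinner : ∀ x ∈ S.V k, ∀ y ∈ S.V k, ∑ a ∈ A, ∑ b ∈ A, ψ a b *
      (((if g y = a then 1 else 0) - (if g x = a then 1 else 0)) *
        ((if g y = b then 1 else 0) - (if g x = b then 1 else 0))) =
      -(ψ (g x) (g y) + ψ (g y) (g x)) := by
    intro x hx y hy
    simp [mul_sub, Finset.sum_sub_distrib, hg x hx, hg y hy, hψ]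
    ring
  have hsum : ∑ a ∈ A, ∑ b ∈ A, ψ a b *
      H.form k (fun x => if g x = a then 1 else 0) (fun x => if g x = b then 1 else 0) =
      1 / 2 * H.edgeSum k (fun x y => ∑ a ∈ A, ∑ b ∈ A, ψ a b *
      (((if g y = a then 1 else 0) - (if g x = a then 1 else 0)) *
        ((if g y = b then 1 else 0) - (if g x = b then 1 else 0)))) := by
    simp only [form, edgeSum, Finset.mul_sum]
    simp only [Finset.sum_comm (s := A) (t := S.verts k)]
    refine Finset.sum_congr rfl fun x _ => Finset.sum_congr rfl fun y _ =>
      Finset.sum_congr rfl fun a _ => Finset.sum_congr rfl fun b _ => ?_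
    ring
  rw [hsum, edgeSum_congr hinner]
  have hneg : (fun x y => -(ψ (g x) (g y) + ψ (g y) (g x))) =
      fun x y => (-1) * (ψ (g x) (g y) + ψ (g y) (g x)) := by
    ext x y
    ring
  rw [hneg, edgeSum_const_mul, edgeSum_add, H.edgeSum_swap k fun x y => ψ (g x) (g y)]
  ring

theorem form_succ (k : ℕ) (u φ : K → ℝ) :
    H.form (k + 1) u φ = ∑ j, 1 / H.r j * H.form k (u ∘ S.F j) (φ ∘ S.F j) := by
  have h : ∀ u : K → ℝ, H.form (k + 1) u u =
      ∑ j, 1 / H.r j * H.form k (u ∘ S.F j) (u ∘ S.F j) := fun u => by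
    simpa only [energy_eq_form] using H.self_similar k u
  have h₁ := h (u + φ)
  simp only [Pi.add_comp, form_add_left, form_add_right, mul_add, Finset.sum_add_distrib] at h₁
  simp only [H.form_symm _ φ, H.form_symm _ (φ ∘ _) (u ∘ _)] at h₁
  have hu := h u
  have hφ := h φ
  linarith

theorem edgeSum_succ (k : ℕ) {ψ : K → K → ℝ} (hψ : ∀ x, ψ x x = 0) :
    H.edgeSum (k + 1) ψ =
      ∑ j, 1 / H.r j * H.edgeSum k fun x y => ψ (S.F j x) (S.F j y) := by
  classical
  have h₁ := H.edgeSum_comp_eq_sum_form (k + 1) (S.verts (k + 1)) id (by simp) hψ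
  have h₂ := fun j => H.edgeSum_comp_eq_sum_form k (S.verts (k + 1)) (S.F j)
    (fun x hx => S.mem_verts.2 (S.F_mem_V_succ.2 hx)) hψ
  simp only [id] at h₁
  rw [h₁]
  simp only [h₂, form_succ, Finset.mul_sum, mul_neg, Finset.sum_neg_distrib]
  simp only [Finset.sum_comm (s := Finset.univ) (t := S.verts (k + 1))]
  simp only [neg_inj, Function.comp_def]
  refine Finset.sum_congr rfl fun x _ => Finset.sum_congr rfl fun y _ =>
      Finset.sum_congr rfl fun j _ => ?_
  ring

/-- The factor `1 / r_w` by which conductances are multiplied in the cell of the word `w`. -/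
noncomputable def weight (w : List (Fin N)) : ℝ :=
  (w.map fun i => 1 / H.r i).prod

/-- Self-similarity of the conductances: edge sums of level `k + l` split into the cells of
level `l`. -/
theorem edgeSum_add_level (k l : ℕ) {ψ : K → K → ℝ} (hψ : ∀ x, ψ x x = 0) :
    H.edgeSum (k + l) ψ = ∑ w ∈ wordsOfLength N l, H.weight w *
      H.edgeSum k fun x y => ψ (wordMap S.F w x) (wordMap S.F w y) := by
  induction l generalizing ψ with
  | zero => simp [wordsOfLength, weight, wordMap]
  | succ l ih =>
    rw [← add_assoc, edgeSum_succ H _ hψ, sum_wordsOfLength_succ]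
    refine Finset.sum_congr rfl fun j _ => ?_
    rw [ih (ψ := fun x y => ψ (S.F j x) (S.F j y)) fun x => hψ _, Finset.mul_sum]
    simp [weight, wordMap, mul_assoc]

theorem form_add_level (k l : ℕ) (u φ : K → ℝ) :
    H.form (k + l) u φ = ∑ w ∈ wordsOfLength N l, H.weight w *
      H.form k (u ∘ wordMap S.F w) (φ ∘ wordMap S.F w) := by
  rw [form, edgeSum_add_level H k l (by simp), Finset.mul_sum]
  refine Finset.sum_congr rfl fun w _ => ?_
  simp only [form, Function.comp_apply]
  ring

end HarmonicStructure

/-! ### Functions of finite energy are continuous -/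

namespace HarmonicStructure

open Filter Topology

variable {K : Type*} [MetricSpace K] {N : ℕ} {S : PCFFractal K N} (H : HarmonicStructure S)

theorem form_le_form_succ (k : ℕ) (u : K → ℝ) : H.form k u u ≤ H.form (k + 1) u u := by
  have := (H.compatible k u).2 ⟨u, fun _ _ => rfl, rfl⟩
  simpa only [energy_eq_form] using this

theorem form_mono (u : K → ℝ) : Monotone fun k => H.form k u u :=
  monotone_nat_of_le_succ fun k => H.form_le_form_succ k u

theorem form_comp_F_le (k : ℕ) (i : Fin N) (u : K → ℝ) :
    H.form k (u ∘ S.F i) (u ∘ S.F i) ≤ H.r i * H.form (k + 1) u u := by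
  have h : 1 / H.r i * H.form k (u ∘ S.F i) (u ∘ S.F i) ≤ H.form (k + 1) u u := by
    rw [form_succ]
    exact Finset.single_le_sum (f := fun j => 1 / H.r j * H.form k (u ∘ S.F j) (u ∘ S.F j))
      (fun j _ => mul_nonneg (one_div_pos.2 (H.r_pos j)).le (H.form_self_nonneg _ _))
      (Finset.mem_univ i)
  have hr := H.r_pos i
  calc _ = H.r i * (1 / H.r i * H.form k (u ∘ S.F i) (u ∘ S.F i)) := by field_simp
    _ ≤ _ := by gcongr

/-- On a fixed level the energy controls all differences.  The points `y` for which it controls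
`u x - u y` form a set whose indicator has energy zero. -/
theorem exists_sq_sub_le_form (k : ℕ) :
    ∃ C : ℝ, 0 ≤ C ∧ ∀ (u : K → ℝ), ∀ x ∈ S.V k, ∀ y ∈ S.V k,
      (u x - u y) ^ 2 ≤ C * H.form k u u := by
  classical
  have key : ∀ x ∈ S.V k, ∀ y ∈ S.V k,
      ∃ C : ℝ, 0 ≤ C ∧ ∀ u : K → ℝ, (u x - u y) ^ 2 ≤ C * H.form k u u := by
    intro x hx y hy
    set P : K → Prop := fun y => ∃ C : ℝ, 0 ≤ C ∧ ∀ u : K → ℝ,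
      (u x - u y) ^ 2 ≤ C * H.form k u u with hP
    have hstep : ∀ a ∈ S.V k, ∀ b ∈ S.V k, a ≠ b → H.c k a b ≠ 0 → P a → P b := by
      rintro a ha b hb hab hc ⟨C, hC0, hC⟩
      have hc' : 0 < H.c k a b := lt_of_le_of_ne (H.nonneg k a ha b hb hab) (Ne.symm hc)
      refine ⟨2 * (C + 2 / H.c k a b), by positivity, fun u => ?_⟩
      have hedge : H.c k a b * (u b - u a) ^ 2 ≤ 2 * H.form k u u := by
        have hnn : ∀ x ∈ S.verts k, ∀ y ∈ S.verts k,
            0 ≤ H.c k x y * ((u y - u x) * (u y - u x)) := by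
          intro x hx y hy
          by_cases hxy : x = y
          · simp [hxy]
          · exact mul_nonneg (H.nonneg k x (S.mem_verts.1 hx) y (S.mem_verts.1 hy) hxy)
              (mul_self_nonneg _)
        have h₁ := Finset.single_le_sum (f := fun y => H.c k a y * ((u y - u a) * (u y - u a)))
          (fun y hy => hnn a (S.mem_verts.2 ha) y hy) (S.mem_verts.2 hb)
        have h₂ := Finset.single_le_sum
          (f := fun x => ∑ y ∈ S.verts k, H.c k x y * ((u y - u x) * (u y - u x)))
          (fun x hx => Finset.sum_nonneg (hnn x hx)) (S.mem_verts.2 ha)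
        have h₃ : 2 * H.form k u u =
          ∑ x ∈ S.verts k, ∑ y ∈ S.verts k, H.c k x y * ((u y - u x) * (u y - u x)) := by
          simp only [form, edgeSum]; ring
        rw [h₃, sq]
        exact h₁.trans h₂
      have hedge' : (u b - u a) ^ 2 ≤ 2 / H.c k a b * H.form k u u := by
        rw [div_mul_eq_mul_div, le_div_iff₀ hc']
        linarith
      nlinarith [hC u, sq_nonneg ((u x - u a) - (u a - u b))]
    have hPx : P x := ⟨0, le_rfl, by simp⟩
    have hzero : S.energy k (H.c k) (fun z => if P z then 1 else 0) = 0 := by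
      rw [PCFFractal.energy, Finset.sum_eq_zero, mul_zero]
      intro a ha
      refine Finset.sum_eq_zero fun b hb => ?_
      rw [S.mem_verts] at ha hb
      by_cases hab : a = b
      · simp [hab]
      by_cases hc : H.c k a b = 0
      · simp [hc]
      have hc' : H.c k b a ≠ 0 := by rwa [H.symm k b hb a ha]
      have : P a ↔ P b := ⟨hstep a ha b hb hab hc, hstep b hb a ha (Ne.symm hab) hc'⟩
      simp [this]
    have := H.definite k _ hzero x hx y hy
    by_contra hPy
    have hPy' : ¬ P y := hPy
    simp [hPx, hPy'] at this
  choose! C hC0 hC using key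
  refine ⟨∑ x ∈ S.verts k, ∑ y ∈ S.verts k, C x y,
    Finset.sum_nonneg fun x hx => Finset.sum_nonneg fun y hy =>
      hC0 x (S.mem_verts.1 hx) y (S.mem_verts.1 hy), fun u x hx y hy => ?_⟩
  refine (hC x hx y hy u).trans (mul_le_mul_of_nonneg_right ?_ (H.form_self_nonneg k u))
  have h₁ := Finset.single_le_sum (f := fun y => C x y)
    (fun y hy => hC0 x hx y (S.mem_verts.1 hy)) (S.mem_verts.2 hy)
  have h₂ := Finset.single_le_sum (f := fun x => ∑ y ∈ S.verts k, C x y)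
    (fun x hx => Finset.sum_nonneg fun y hy =>
      hC0 x (S.mem_verts.1 hx) y (S.mem_verts.1 hy)) (S.mem_verts.2 hx)
  exact h₁.trans h₂

theorem exists_r_le : ∃ s : ℝ, 0 < s ∧ s < 1 ∧ ∀ i, H.r i ≤ s ^ 2 := by
  set t : Fin N → NNReal := fun i => Real.toNNReal (H.r i)
  set T := max (Finset.univ.sup t) (1 / 2)
  have hT : T < 1 := max_lt ((Finset.sup_lt_iff (by simp)).2 fun i _ => by
    simpa [t] using H.r_lt_one i) (by
      rw [← NNReal.coe_lt_coe]
      norm_num)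
  have hT0 : 0 < T := lt_max_of_lt_right (by norm_num)
  refine ⟨Real.sqrt T, Real.sqrt_pos.2 (by exact_mod_cast hT0), ?_, fun i => ?_⟩
  · rw [Real.sqrt_lt' one_pos, one_pow]
    exact_mod_cast hT
  · rw [Real.sq_sqrt T.coe_nonneg]
    calc H.r i ≤ (t i : ℝ) := Real.le_coe_toNNReal _
      _ ≤ T := by
        exact_mod_cast (Finset.le_sup (f := t) (Finset.mem_univ i)).trans (le_max_left _ _)

/-- The energy controls all differences, uniformly in the level.  Each refinement of the vertex set
adds a step that is smaller by the factor `max √r_i < 1`, and the geometric series converges. -/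
theorem exists_abs_sub_le_sqrt_form :
    ∃ C : ℝ, 0 ≤ C ∧ ∀ (k : ℕ) (u : K → ℝ), ∀ x ∈ S.V k, ∀ y ∈ S.V k,
      |u x - u y| ≤ C * Real.sqrt (H.form k u u) := by
  obtain ⟨D₀, hD₀, h₀⟩ := H.exists_sq_sub_le_form 0
  obtain ⟨D₁, hD₁, h₁⟩ := H.exists_sq_sub_le_form 1
  obtain ⟨s, hs0, hs1, hs⟩ := H.exists_r_le
  obtain ⟨p, hp⟩ := S.V_zero_nonempty
  set D := Real.sqrt (D₀ + D₁)
  have habs : ∀ k D', D' ≤ D₀ + D₁ → (∀ (u : K → ℝ), ∀ x ∈ S.V k, ∀ y ∈ S.V k,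
      (u x - u y) ^ 2 ≤ D' * H.form k u u) → ∀ (u : K → ℝ), ∀ x ∈ S.V k, ∀ y ∈ S.V k,
      |u x - u y| ≤ D * Real.sqrt (H.form k u u) := by
    intro k D' hD' h u x hx y hy
    rw [← Real.sqrt_mul (by positivity)]
    exact Real.abs_le_sqrt ((h u x hx y hy).trans
      (mul_le_mul_of_nonneg_right hD' (H.form_self_nonneg k u)))
  have h₀' := habs 0 D₀ (by linarith) h₀
  have h₁' := habs 1 D₁ (by linarith) h₁
  set a := D / (1 - s)
  have hD : 0 ≤ D := Real.sqrt_nonneg _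
  have ha : 0 ≤ a := div_nonneg hD (by linarith)
  have haD : a * s + D = a := by
    have : 1 - s ≠ 0 := by linarith
    simp only [a]
    field_simp
    ring
  have key : ∀ (k : ℕ) (u : K → ℝ), ∀ x ∈ S.V k,
      |u x - u p| ≤ a * Real.sqrt (H.form k u u) := by
    intro k
    induction k with
    | zero =>
      intro u x hx
      refine (h₀' u x hx p hp).trans (mul_le_mul_of_nonneg_right ?_ (Real.sqrt_nonneg _))
      nlinarith
    | succ k ih =>
      intro u x hx
      obtain ⟨i, y, hy, rfl⟩ := S.mem_V_succ.1 hx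
      have e₁ : |u (S.F i y) - u (S.F i p)| ≤ a * (s * Real.sqrt (H.form (k + 1) u u)) := by
        refine (ih (u ∘ S.F i) y hy).trans (mul_le_mul_of_nonneg_left ?_ ha)
        rw [← Real.sqrt_sq hs0.le, ← Real.sqrt_mul (sq_nonneg s)]
        refine Real.sqrt_le_sqrt ((H.form_comp_F_le k i u).trans ?_)
        exact mul_le_mul_of_nonneg_right (hs i) (H.form_self_nonneg _ _)
      have e₂ : |u (S.F i p) - u p| ≤ D * Real.sqrt (H.form (k + 1) u u) := by
        refine (h₁' u _ (S.F_mem_V_succ.2 hp) p (S.V_mono zero_le_one hp)).trans ?_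
        refine mul_le_mul_of_nonneg_left (Real.sqrt_le_sqrt ?_) hD
        exact H.form_mono u (by omega)
      calc _ ≤ |u (S.F i y) - u (S.F i p)| + |u (S.F i p) - u p| := abs_sub_le _ _ _
        _ ≤ (a * s + D) * Real.sqrt (H.form (k + 1) u u) := by linarith
        _ = _ := by rw [haD]
  refine ⟨2 * a, by positivity, fun k u x hx y hy => ?_⟩
  have e := abs_sub_le (u x) (u p) (u y)
  have e₁ := key k u x hx
  have e₂ := key k u y hy
  rw [abs_sub_comm] at e₂
  linarith

theorem form_comp_wordMap_le {s : ℝ} (hs : ∀ i, H.r i ≤ s ^ 2) (k : ℕ)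
    (w : List (Fin N)) (u : K → ℝ) :
    H.form k (u ∘ wordMap S.F w) (u ∘ wordMap S.F w) ≤
      (s ^ w.length) ^ 2 * H.form (k + w.length) u u := by
  induction w generalizing u with
  | nil => simp [wordMap]
  | cons i w ih =>
    calc _ ≤ (s ^ w.length) ^ 2 * H.form (k + w.length) (u ∘ S.F i) (u ∘ S.F i) := ih (u ∘ S.F i)
      _ ≤ (s ^ w.length) ^ 2 * (s ^ 2 * H.form (k + w.length + 1) u u) := by
        gcongr
        refine (H.form_comp_F_le _ i u).trans ?_
        exact mul_le_mul_of_nonneg_right (hs i) (H.form_self_nonneg _ _)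
      _ = _ := by
        rw [List.length_cons, ← add_assoc]
        ring

/-- A function of finite energy on the vertices of all levels extends continuously to `K`. -/
theorem exists_continuous_extension [CompactSpace K] (u : K → ℝ) (B : ℝ)
    (hB : ∀ k, H.form k u u ≤ B) :
    ∃ h : C(K, ℝ), ∀ k, ∀ x ∈ S.V k, h x = u x := by
  obtain ⟨C, hC0, hC⟩ := H.exists_abs_sub_le_sqrt_form
  obtain ⟨s, hs0, hs1, hs⟩ := H.exists_r_le
  have hosc : ∀ ε > 0, ∃ l : ℕ, ∀ w : List (Fin N), w.length = l → ∀ k,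
      ∀ x ∈ S.V k, ∀ y ∈ S.V k, |u (wordMap S.F w x) - u (wordMap S.F w y)| < ε := by
    intro ε hε
    have hlim : Tendsto (fun l : ℕ => C * (s ^ l * Real.sqrt B)) atTop (𝓝 0) := by
      simpa using ((tendsto_pow_atTop_nhds_zero_of_lt_one hs0.le hs1).mul_const
        (Real.sqrt B)).const_mul C
    obtain ⟨l, hl⟩ := (hlim.eventually_lt_const hε).exists
    refine ⟨l, fun w hw k x hx y hy => (hC k (u ∘ wordMap S.F w) x hx y hy).trans_lt ?_⟩
    refine lt_of_le_of_lt (mul_le_mul_of_nonneg_left ?_ hC0) hl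
    rw [← Real.sqrt_sq (pow_nonneg hs0.le l), ← Real.sqrt_mul (sq_nonneg _)]
    refine Real.sqrt_le_sqrt ((H.form_comp_wordMap_le hs k w u).trans ?_)
    rw [hw]
    exact mul_le_mul_of_nonneg_left (hB _) (sq_nonneg _)
  have hosc' : ∀ ε > 0, ∃ l : ℕ, ∀ w : List (Fin N), w.length = l →
      ∀ x ∈ S.cell w, ∀ y ∈ S.cell w, x ∈ (⋃ k, S.V k) → y ∈ (⋃ k, S.V k) → |u x - u y| < ε := by
    intro ε hε
    obtain ⟨l, hl⟩ := hosc ε hε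
    refine ⟨l, ?_⟩
    rintro w hw _ ⟨x, rfl⟩ _ ⟨y, rfl⟩ hx hy
    obtain ⟨i, hi⟩ := Set.mem_iUnion.1 hx
    obtain ⟨j, hj⟩ := Set.mem_iUnion.1 hy
    exact hl w hw (max i j) x (S.wordMap_mem_V.1 (S.V_mono (by omega) hi))
      y (S.wordMap_mem_V.1 (S.V_mono (by omega) hj))
  set ι : (⋃ k, S.V k) → K := Subtype.val
  have hι : IsDenseInducing ι := ⟨⟨rfl⟩, S.dense_iUnion_V.denseRange_val⟩
  have hlim : ∀ b : K, ∃ c, Tendsto (fun x : (⋃ k, S.V k) => u x) (comap ι (𝓝 b)) (𝓝 c) := by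
    intro b
    have : (comap ι (𝓝 b)).NeBot := hι.comap_nhds_neBot b
    rw [← cauchy_map_iff_exists_tendsto, Metric.cauchy_iff]
    refine ⟨inferInstance, fun ε hε => ?_⟩
    obtain ⟨l, hl⟩ := hosc' (ε / 2) (half_pos hε)
    refine ⟨_, image_mem_map (preimage_mem_comap (S.eventually_exists_mem_cell l b)), ?_⟩
    rintro _ ⟨⟨x, hx⟩, ⟨w, hw, hbw, hxw⟩, rfl⟩ _ ⟨⟨y, hy⟩, ⟨w', hw', hbw', hyw'⟩, rfl⟩
    rw [Real.dist_eq]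
    by_cases hww : w = w'
    · subst hww
      exact (hl w hw x hxw y hyw' hx hy).trans (half_lt_self hε)
    · -- a point of two different cells is a vertex, so `u b` makes sense
      have hb : b ∈ ⋃ k, S.V k := by
        obtain ⟨p, rfl⟩ := hbw
        obtain ⟨q, hq⟩ := hbw'
        exact Set.mem_iUnion.2 ⟨_, S.wordMap_mem_V.2
          (S.mem_V_zero_of_wordMap_eq (hw.trans hw'.symm) hww hq.symm)⟩
      have e₁ := hl w hw x hxw b hbw hx hb
      have e₂ := hl w' hw' b hbw' y hyw' hb hy
      have e := abs_sub_le (u x) (u b) (u y)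
      show |u x - u y| < ε
      linarith
  refine ⟨⟨hι.extend fun x => u x, hι.continuous_extend hlim⟩, fun k x hx => ?_⟩
  obtain ⟨c, hc⟩ := hlim x
  set x' : (⋃ k, S.V k) := ⟨x, Set.mem_iUnion.2 ⟨k, hx⟩⟩
  have e : hι.extend (fun x : (⋃ k, S.V k) => u x) x = c := hι.extend_eq_of_tendsto hc
  have e' : u x = c := tendsto_nhds_unique (tendsto_pure_nhds (fun x : (⋃ k, S.V k) => u x) x')
    (hc.mono_left (by
      rw [pure_le_iff]
      rintro t ⟨t', ht', h⟩
      exact h (mem_of_mem_nhds (x := x) ht')))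
  exact e.trans e'.symm

end HarmonicStructure

/-! ### Harmonic functions -/

namespace HarmonicStructure

variable {K : Type*} [MetricSpace K] {N : ℕ} {S : PCFFractal K N} (H : HarmonicStructure S)

theorem form_congr {k : ℕ} {u u' φ φ' : K → ℝ} (hu : ∀ x ∈ S.V k, u x = u' x)
    (hφ : ∀ x ∈ S.V k, φ x = φ' x) : H.form k u φ = H.form k u' φ' := by
  rw [form, form, edgeSum_congr fun x hx y hy => by rw [hu x hx, hu y hy, hφ x hx, hφ y hy]]

/-- A real function on `K` is harmonic (off the boundary `V₀`) if its pairings with test functions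
do not depend on the level.  For a test function that vanishes on `V₀` they are then zero. -/
def IsHarmonic (h : K → ℝ) : Prop :=
  ∀ (k : ℕ) (φ : K → ℝ), H.form k h φ = H.form 0 h φ

/-- One step of the harmonic extension: a minimizer of `E_{k+1}` makes the nonnegative quadratic form
`E_{k+1} - E_k` vanish, hence lies in its kernel. -/
theorem exists_harmonic_step (k : ℕ) (v : K → ℝ) :
    ∃ u : K → ℝ, (∀ x ∈ S.V k, u x = v x) ∧ ∀ φ, H.form (k + 1) u φ = H.form k u φ := by
  obtain ⟨u, hu, he⟩ := (H.compatible k v).1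
  refine ⟨u, hu, fun φ => ?_⟩
  rw [energy_eq_form, energy_eq_form, ← H.form_congr hu hu] at he
  have hvar : ∀ t : ℝ, 0 ≤ 2 * t * (H.form (k + 1) u φ - H.form k u φ) +
      t ^ 2 * (H.form (k + 1) φ φ - H.form k φ φ) := by
    intro t
    have h := H.form_le_form_succ k (u + t • φ)
    simp only [form_add_left, form_add_right, form_smul_left, form_smul_right,
      H.form_symm _ φ u] at h
    linarith
  have hq : 0 ≤ H.form (k + 1) φ φ - H.form k φ φ := sub_nonneg.2 (H.form_le_form_succ k φ)
  set d := H.form (k + 1) u φ - H.form k u φ with hd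
  set q := H.form (k + 1) φ φ - H.form k φ φ
  have h := hvar (-d / (q + 1))
  have h' : 2 * (-d / (q + 1)) * d + (-d / (q + 1)) ^ 2 * q =
      -(d ^ 2 * (q + 2)) / (q + 1) ^ 2 := by
    field_simp
    ring
  rw [h', le_div_iff₀ (by positivity)] at h
  have : d ^ 2 = 0 := by nlinarith [sq_nonneg d, mul_nonneg (sq_nonneg d) hq]
  have : d = 0 := by simpa using this
  linarith

/-- Every function on the boundary has a continuous harmonic extension. -/
theorem exists_harmonic_extension [CompactSpace K] (v : K → ℝ) :
    ∃ h : C(K, ℝ), (∀ x ∈ S.V 0, h x = v x) ∧ H.IsHarmonic h := by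
  classical
  choose step hstep hform using H.exists_harmonic_step
  let u : ℕ → K → ℝ := fun k => Nat.rec v (fun k u => step k u) k
  have hu : ∀ j k, j ≤ k → ∀ x ∈ S.V j, u k x = u j x := by
    intro j k hjk x hx
    induction k, hjk using Nat.le_induction with
    | base => rfl
    | succ k hjk ih => exact (hstep k (u k) x (S.V_mono hjk hx)).trans ih
  let U : K → ℝ := fun x => if hx : ∃ k, x ∈ S.V k then u (Nat.find hx) x else 0
  have hU : ∀ k, ∀ x ∈ S.V k, U x = u k x := by
    intro k x hx
    have hx' : ∃ k, x ∈ S.V k := ⟨k, hx⟩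
    simp only [U, dif_pos hx']
    exact (hu _ k (Nat.find_min' hx' hx) x (Nat.find_spec hx')).symm
  have hUform : ∀ (k : ℕ) (φ : K → ℝ), H.form k U φ = H.form 0 U φ := by
    intro k φ
    induction k with
    | zero => rfl
    | succ k ih =>
      rw [← ih, H.form_congr (hU (k + 1)) fun _ _ => rfl, H.form_congr (hU k) fun _ _ => rfl]
      exact (hform k (u k) φ).trans (H.form_congr (hstep k (u k)) fun _ _ => rfl)
  obtain ⟨h, hh⟩ := H.exists_continuous_extension U (H.form 0 U U) fun k => (hUform k U).le
  refine ⟨h, fun x hx => (hh 0 x hx).trans (hU 0 x hx), fun k φ => ?_⟩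
  rw [H.form_congr (hh k) fun _ _ => rfl, H.form_congr (hh 0) fun _ _ => rfl, hUform]

/-- The Dirichlet problem of level `M` with a source `ℓ`: the form is positive definite on the
functions on `V_M` that vanish on `V₀`. -/
theorem exists_form_eq (M : ℕ) (ℓ : (K → ℝ) →ₗ[ℝ] ℝ)
    (hℓ : ∀ φ φ' : K → ℝ, (∀ x ∈ S.V M, φ x = φ' x) → ℓ φ = ℓ φ') :
    ∃ X : K → ℝ, (∀ x ∈ S.V 0, X x = 0) ∧
      ∀ φ : K → ℝ, (∀ x ∈ S.V 0, φ x = 0) → H.form M X φ = ℓ φ := by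
  classical
  let I := {x // x ∈ S.verts M \ S.verts 0}
  let ext : (I → ℝ) →ₗ[ℝ] (K → ℝ) := Function.ExtendByZero.linearMap ℝ Subtype.val
  have ext_coe : ∀ (s : I → ℝ) (x : I), ext s x = s x := fun s x =>
    Subtype.val_injective.extend_apply s 0 x
  have ext_zero : ∀ (s : I → ℝ), ∀ x ∈ S.V 0, ext s x = 0 := fun s x hx =>
    Function.extend_apply' (f := ((↑) : I → K)) s (0 : K → ℝ) x (by
      rintro ⟨y, rfl⟩
      exact (Finset.mem_sdiff.1 y.2).2 (S.mem_verts.2 hx))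
  let B : (I → ℝ) →ₗ[ℝ] (I → ℝ) →ₗ[ℝ] ℝ := LinearMap.mk₂ ℝ (fun s t => H.form M (ext s) (ext t))
    (fun s s' t => by rw [map_add, form_add_left])
    (fun a s t => by rw [map_smul, form_smul_left, smul_eq_mul])
    (fun s t t' => by rw [map_add, form_add_right])
    (fun a s t => by rw [map_smul, form_smul_right, smul_eq_mul])
  have hinj : Function.Injective B := by
    rw [injective_iff_map_eq_zero]
    intro s hs
    have h0 : H.form M (ext s) (ext s) = 0 := congrArg (fun g => g s) hs
    rw [← energy_eq_form] at h0
    obtain ⟨p, hp⟩ := S.V_zero_nonempty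
    ext x
    have hx : (x : K) ∈ S.V M := S.mem_verts.1 (Finset.mem_sdiff.1 x.2).1
    rw [← ext_coe s x, H.definite M _ h0 x hx p (S.V_mono (Nat.zero_le M) hp), ext_zero s p hp]
    rfl
  have hsurj : Function.Surjective B :=
    (LinearMap.injective_iff_surjective_of_finrank_eq_finrank
      (Subspace.dual_finrank_eq (K := ℝ) (V := I → ℝ)).symm).1 hinj
  obtain ⟨s, hs⟩ := hsurj (ℓ ∘ₗ ext)
  refine ⟨ext s, ext_zero s, fun φ hφ => ?_⟩
  have hφ' : ∀ x ∈ S.V M, φ x = ext (fun x => φ x) x := by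
    intro x hx
    by_cases hx0 : x ∈ S.V 0
    · rw [hφ x hx0, ext_zero _ x hx0]
    · exact (ext_coe (fun x => φ x) ⟨x, by simp [hx, hx0]⟩).symm
  rw [H.form_congr (u' := ext s) (fun _ _ => rfl) hφ', hℓ _ _ hφ']
  exact congrArg (fun g => g fun x => φ x) hs

/-- Prescribing jumps `a w` on the cells of level `M` and the values `b` on the boundary, there are
harmonic functions on the cells with exactly these jumps whose fluxes balance at the vertices. -/
theorem exists_harmonic_cells [CompactSpace K] (M : ℕ) (a : List (Fin N) → K → ℝ) (b : K → ℝ) :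
    ∃ (U : K → ℝ) (h : List (Fin N) → C(K, ℝ)), (∀ x ∈ S.V 0, U x = b x) ∧
      (∀ w, ∀ x ∈ S.V 0, h w x = U (wordMap S.F w x) + a w (wordMap S.F w x)) ∧
      (∀ w, H.IsHarmonic (h w)) ∧
      ∀ φ : K → ℝ, (∀ x ∈ S.V 0, φ x = 0) →
        ∑ w ∈ wordsOfLength N M, H.weight w * H.form 0 (h w) (φ ∘ wordMap S.F w) = 0 := by
  let ℓ : (K → ℝ) →ₗ[ℝ] ℝ :=
    { toFun := fun φ => -∑ w ∈ wordsOfLength N M, H.weight w *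
        H.form 0 ((b + a w) ∘ wordMap S.F w) (φ ∘ wordMap S.F w)
      map_add' := fun φ φ' => by
        simp only [Pi.add_comp, form_add_right, mul_add, Finset.sum_add_distrib, neg_add]
      map_smul' := fun t φ => by
        simp only [Pi.smul_comp, form_smul_right, mul_left_comm _ t, ← Finset.mul_sum,
          RingHom.id_apply, smul_eq_mul, mul_neg] }
  have hmem : ∀ w ∈ wordsOfLength N M, ∀ x ∈ S.V 0, wordMap S.F w x ∈ S.V M := by
    intro w hw x hx
    have := (S.wordMap_mem_V (w := w)).2 hx
    rwa [mem_wordsOfLength.1 hw, zero_add] at this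
  obtain ⟨X, hX0, hX⟩ := H.exists_form_eq M ℓ fun φ φ' h => by
    refine congrArg Neg.neg (Finset.sum_congr rfl fun w hw => ?_)
    exact congrArg _ (H.form_congr (fun _ _ => rfl) fun x hx => h _ (hmem w hw x hx))
  choose h hval hharm using fun w =>
    H.exists_harmonic_extension ((b + X + a w) ∘ wordMap S.F w)
  refine ⟨b + X, h, fun x hx => by simp [hX0 x hx], fun w x hx => hval w x hx, hharm,
    fun φ hφ => ?_⟩
  have hXφ := hX φ hφ
  have hlevel := H.form_add_level 0 M X φ
  rw [zero_add] at hlevel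
  have hsplit : ∀ w, H.form 0 (h w) (φ ∘ wordMap S.F w) =
      H.form 0 (X ∘ wordMap S.F w) (φ ∘ wordMap S.F w) +
        H.form 0 ((b + a w) ∘ wordMap S.F w) (φ ∘ wordMap S.F w) := by
    intro w
    rw [← form_add_left]
    refine H.form_congr (fun x hx => (hval w x hx).trans ?_) fun _ _ => rfl
    simp only [Function.comp_apply, Pi.add_apply]
    ring
  simp only [hsplit, mul_add, Finset.sum_add_distrib]
  rw [← hlevel, hXφ]
  exact neg_add_cancel _

end HarmonicStructure

/-! ### Lifts and degrees of circle-valued maps -/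

section Circle

theorem circleRep_coe {t : ℝ} (ht : |t| < 1 / 2) : circleRep (t : UnitAddCircle) = t := by
  rw [abs_lt] at ht
  exact AddCircle.equivIoc_coe_of_mem ⟨by linarith, by linarith⟩

theorem continuous_coe_unitAddCircle : Continuous ((↑) : ℝ → UnitAddCircle) :=
  AddCircle.continuous_mk' 1

theorem exists_isLift (g : C(UnitAddCircle, UnitAddCircle)) : ∃ G : ℝ → ℝ, IsLift g G := by
  obtain ⟨e, he⟩ := QuotientAddGroup.mk_surjective (g ((0 : ℝ) : UnitAddCircle))
  obtain ⟨F, ⟨-, hF⟩, -⟩ := (AddCircle.isCoveringMap_coe (1 : ℝ)).existsUnique_continuousMap_lifts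
    (g.comp ⟨((↑) : ℝ → UnitAddCircle), continuous_coe_unitAddCircle⟩) (0 : ℝ) e he
  exact ⟨F, F.continuous, fun t => congrFun hF t⟩

/-- Two lifts of the same path in the circle have the same increments. -/
theorem sub_eq_sub_of_coe_eq {s : Set ℝ} (hs : IsPreconnected s) {A B : ℝ → ℝ}
    (hA : ContinuousOn A s) (hB : ContinuousOn B s)
    (h : ∀ t ∈ s, (A t : UnitAddCircle) = (B t : UnitAddCircle)) {x y : ℝ} (hx : x ∈ s)
    (hy : y ∈ s) : A y - A x = B y - B x := by
  have hmaps : Set.MapsTo (fun t => A t - B t) s (AddSubgroup.zmultiples (1 : ℝ) : Set ℝ) := by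
    intro t ht
    refine (QuotientAddGroup.eq_zero_iff _).1 ?_
    rw [QuotientAddGroup.mk_sub, sub_eq_zero]
    exact h t ht
  have hdisc : DiscreteTopology (AddSubgroup.zmultiples (1 : ℝ) : Set ℝ) :=
    inferInstanceAs (DiscreteTopology (AddSubgroup.zmultiples (1 : ℝ)))
  have := hs.constant_of_mapsTo ⟨hdisc⟩ (hA.sub hB) hmaps hx hy
  simp only [Pi.sub_apply] at this
  linarith

theorem IsLift.exists_degree {g : C(UnitAddCircle, UnitAddCircle)} {G : ℝ → ℝ} (hG : IsLift g G) :
    ∃ ρ : ℤ, HasDegree g ρ ∧ ∀ t, G (t + 1) - G t = ρ := by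
  have hper : ∀ t : ℝ, (G (t + 1) : UnitAddCircle) = (G t : UnitAddCircle) := by
    intro t
    rw [hG.2, hG.2, AddCircle.coe_add_period]
  have hint : (((G 1 - G 0 : ℝ)) : UnitAddCircle) = 0 := by
    rw [AddCircle.coe_sub, sub_eq_zero]
    simpa using hper 0
  obtain ⟨ρ, hρ⟩ := (AddCircle.coe_eq_zero_iff 1).1 hint
  rw [zsmul_eq_mul, mul_one] at hρ
  refine ⟨ρ, ⟨G, hG, hρ.symm⟩, fun t => ?_⟩
  have := sub_eq_sub_of_coe_eq (A := fun t => G (t + 1)) isPreconnected_univ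
    (hG.1.comp (continuous_add_const 1)).continuousOn hG.1.continuousOn
    (fun t _ => hper t) (Set.mem_univ (0 : ℝ)) (Set.mem_univ t)
  simp only [zero_add] at this
  linarith

end Circle

namespace PCFFractal

variable {K : Type*} [MetricSpace K] {N : ℕ} (S : PCFFractal K N)

/-- Along a path inside a cell, a circle-valued map with a real lift on the cell increases by the
difference of the values of that lift. -/
theorem lift_sub_eq_of_mem_cell [CompactSpace K] {f : C(K, UnitAddCircle)} {g : C(K, ℝ)}
    {w : List (Fin N)} (hf : ∀ x, f (wordMap S.F w x) = (g x : UnitAddCircle))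
    {c : C(UnitAddCircle, K)} {G : ℝ → ℝ} (hG : IsLift (f.comp c) G) {a b : ℝ} (hab : a ≤ b)
    (hc : ∀ t ∈ Set.Icc a b, c (t : UnitAddCircle) ∈ S.cell w) {p q : K}
    (hp : wordMap S.F w p = c (a : UnitAddCircle)) (hq : wordMap S.F w q = c (b : UnitAddCircle)) :
    G b - G a = g q - g p := by
  have : Nonempty K := ⟨p⟩
  have hemb := ((S.continuous_wordMap w).isClosedEmbedding (S.injective_wordMap w)).isEmbedding
  set x : ℝ → K := fun t => Function.invFun (wordMap S.F w) (c (t : UnitAddCircle))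
  have hx : ∀ t ∈ Set.Icc a b, wordMap S.F w (x t) = c (t : UnitAddCircle) :=
    fun t ht => Function.invFun_eq (hc t ht)
  have hxc : ContinuousOn x (Set.Icc a b) := by
    rw [hemb.continuousOn_iff]
    exact (c.continuous.comp continuous_coe_unitAddCircle).continuousOn.congr hx
  have hxp : x a = p := S.injective_wordMap w ((hx a ⟨le_rfl, hab⟩).trans hp.symm)
  have hxq : x b = q := S.injective_wordMap w ((hx b ⟨hab, le_rfl⟩).trans hq.symm)
  have := sub_eq_sub_of_coe_eq isPreconnected_Icc hG.1.continuousOn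
    (g.continuous.comp_continuousOn hxc) (fun t ht => ?_) (Set.left_mem_Icc.2 hab)
    (Set.right_mem_Icc.2 hab)
  · simpa only [Function.comp_apply, hxp, hxq] using this
  · rw [hG.2, Function.comp_apply, ← hf, hx t ht]
    rfl

end PCFFractal

/-! ### Harmonic maps from harmonic functions on the cells -/

namespace HarmonicStructure

open Filter Topology

variable {K : Type*} [MetricSpace K] {N : ℕ} {S : PCFFractal K N} (H : HarmonicStructure S)

/-- A circle-valued map is harmonic if on each cell of level `M` it lifts to a harmonic function `h w`
and if the fluxes of these functions balance at the vertices. -/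
theorem isHarmonicMap_of_cells [CompactSpace K] (M : ℕ) (f : C(K, UnitAddCircle))
    (h : List (Fin N) → C(K, ℝ))
    (hf : ∀ w, w.length = M → ∀ x, f (wordMap S.F w x) = (h w x : UnitAddCircle))
    (hh : ∀ w, H.IsHarmonic (h w))
    (hflux : ∀ φ : K → ℝ, (∀ x ∈ S.V 0, φ x = 0) →
      ∑ w ∈ wordsOfLength N M, H.weight w * H.form 0 (h w) (φ ∘ wordMap S.F w) = 0) :
    H.IsHarmonicMap f := by
  classical
  have hsmall : ∀ w, ∃ L₀ : ℕ, ∀ s : List (Fin N), L₀ ≤ s.length → ∀ x y,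
      |h w (wordMap S.F s y) - h w (wordMap S.F s x)| < 1 / 2 := by
    intro w
    obtain ⟨ε, hε, hu⟩ := Metric.uniformContinuous_iff.1
      (CompactSpace.uniformContinuous_of_continuous (h w).continuous) (1 / 2) (by norm_num)
    obtain ⟨L₀, hL₀⟩ := S.exists_dist_wordMap_lt hε
    exact ⟨L₀, fun s hs x y => hu (hL₀ s hs y x)⟩
  choose L₀ hL₀ using hsmall
  set L₁ := (wordsOfLength N M).sup L₀
  -- at fine levels, sums over the increments of `f` are sums over the increments of the lifts
  have key : ∀ L, L₁ ≤ L → ∀ Θ : K → K → ℝ → ℝ, (∀ x, Θ x x 0 = 0) →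
      H.edgeSum (L + M) (fun x y => Θ x y (circleRep (f y - f x))) =
        ∑ w ∈ wordsOfLength N M, H.weight w * H.edgeSum L fun x y =>
          Θ (wordMap S.F w x) (wordMap S.F w y) (h w y - h w x) := by
    intro L hL Θ hΘ
    have hrep0 : circleRep 0 = 0 := by
      simpa using circleRep_coe (t := 0) (by norm_num)
    rw [edgeSum_add_level H L M (by simp [hrep0, hΘ])]
    refine Finset.sum_congr rfl fun w hw => congrArg _ ?_
    rw [← zero_add L, edgeSum_add_level H 0 L (by simp [hrep0, hΘ]),
      edgeSum_add_level H 0 L (by simp [hΘ])]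
    refine Finset.sum_congr rfl fun s hs => congrArg _ (edgeSum_congr fun x _ y _ => ?_)
    rw [hf w (mem_wordsOfLength.1 hw), hf w (mem_wordsOfLength.1 hw), ← AddCircle.coe_sub,
      circleRep_coe]
    exact hL₀ w s (by rw [mem_wordsOfLength.1 hs]; exact (Finset.le_sup hw).trans hL) x y
  refine ⟨?_, L₁ + M, fun k hk x hx hx0 => ?_⟩
  · have hconst : ∀ᶠ k in atTop, ∑ w ∈ wordsOfLength N M, H.weight w * H.form 0 (h w) (h w) =
        H.circleEnergy k f := by
      filter_upwards [eventually_ge_atTop (L₁ + M)] with k hk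
      obtain ⟨L, rfl⟩ : ∃ L, k = L + M := ⟨k - M, by omega⟩
      have := key L (by omega) (fun _ _ t => t ^ 2) (by simp)
      rw [edgeSum] at this
      rw [circleEnergy, this, Finset.mul_sum]
      refine Finset.sum_congr rfl fun w _ => ?_
      rw [← hh w L, form]
      simp only [sq]
      ring
    exact (tendsto_const_nhds.congr' hconst).bddAbove_range
  · obtain ⟨L, rfl⟩ : ∃ L, k = L + M := ⟨k - M, by omega⟩
    set φ : K → ℝ := fun y => if y = x then 1 else 0 with hφ
    have hLap : H.circleLaplacian (L + M) f x =
        H.edgeSum (L + M) fun a b => φ a * circleRep (f b - f a) := by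
      simp [circleLaplacian, edgeSum, φ, hx]
    rw [hLap, key L (by omega) (fun a _ t => φ a * t) (by simp)]
    have hsum := hflux φ fun y hy => if_neg (by rintro rfl; exact hx0 hy)
    rw [← neg_eq_zero, ← Finset.sum_neg_distrib, ← hsum]
    refine Finset.sum_congr rfl fun w _ => ?_
    rw [← hh w L, form_eq_neg_edgeSum]
    simp

/-- For integer jumps `A w y` of the local lifts there is a harmonic map whose lifts on the cells of
level `M` are, at the vertices, `U + A w` with one real function `U`.  The boundary values of `U` are
arbitrary. -/
theorem exists_harmonicMap_of_jumps [CompactSpace K] (M : ℕ) (A : List (Fin N) → K → ℤ)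
    (b : K → ℝ) :
    ∃ (U : K → ℝ) (h : List (Fin N) → C(K, ℝ)) (f : C(K, UnitAddCircle)),
      (∀ x ∈ S.V 0, U x = b x) ∧
      (∀ w, ∀ x ∈ S.V 0, h w x = U (wordMap S.F w x) + A w (wordMap S.F w x)) ∧
      (∀ w, w.length = M → ∀ x, f (wordMap S.F w x) = (h w x : UnitAddCircle)) ∧
      H.IsHarmonicMap f := by
  obtain ⟨U, h, hU, hval, hharm, hflux⟩ := H.exists_harmonic_cells M (fun w y => (A w y : ℝ)) b
  have hint : ∀ k : ℤ, ((k : ℝ) : UnitAddCircle) = 0 := fun k =>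
    (AddCircle.coe_eq_zero_iff 1).2 ⟨k, by simp⟩
  obtain ⟨f, hf⟩ := S.exists_glue M (X := UnitAddCircle)
    (fun w => ⟨fun x => (h w x : UnitAddCircle),
      continuous_coe_unitAddCircle.comp (h w).continuous⟩) (by
    intro w w' _ _ p hp q hq hpq
    simp only [ContinuousMap.coe_mk]
    rw [hval w p hp, hval w' q hq, hpq, AddCircle.coe_add, AddCircle.coe_add, hint, hint])
  exact ⟨U, h, f, hU, hval, hf, H.isHarmonicMap_of_cells M f h hf hharm hflux⟩

theorem vert_mem_V {M : ℕ} (γ : GraphCycle (H.graph M)) {k : ℕ} (hk : k < γ.length) :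
    γ.vert k ∈ S.V M ∧ γ.vert (k + 1) ∈ S.V M :=
  have h := γ.walk.adj_getVert_succ hk
  ⟨h.2.1, h.2.2.1⟩

/-- The degree along a loop that traces a cycle is the sum of the jumps of the local lifts: the
contributions of the real function `U` cancel. -/
theorem lift_sub_eq_sum_jumps [CompactSpace K] {M : ℕ} {A : List (Fin N) → K → ℤ} {U : K → ℝ}
    {h : List (Fin N) → C(K, ℝ)} {f : C(K, UnitAddCircle)}
    (hval : ∀ w, ∀ x ∈ S.V 0, h w x = U (wordMap S.F w x) + A w (wordMap S.F w x))
    (hf : ∀ w, w.length = M → ∀ x, f (wordMap S.F w x) = (h w x : UnitAddCircle))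
    {c : C(UnitAddCircle, K)} {γ : GraphCycle (H.graph M)} {w : ℕ → List (Fin N)}
    (hc : H.Traces c γ w) {G : ℝ → ℝ} (hG : IsLift (f.comp c) G) :
    G 1 - G 0 = ((∑ k ∈ Finset.range γ.length,
      (A (w k) (γ.vert (k + 1)) - A (w k) (γ.vert k)) : ℤ) : ℝ) := by
  obtain ⟨τ, hτ, hτ0, hτ1, hvert, hcell⟩ := hc
  have hstep : ∀ k ∈ Finset.range γ.length, G (τ (k + 1)) - G (τ k) =
      (U (γ.vert (k + 1)) - U (γ.vert k)) +
        ((A (w k) (γ.vert (k + 1)) - A (w k) (γ.vert k) : ℤ) : ℝ) := by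
    intro k hk
    rw [Finset.mem_range] at hk
    obtain ⟨hlen, hmem⟩ := hcell k hk
    have hle := hτ (Nat.le_succ k)
    obtain ⟨p, hp⟩ := hmem (τ k) ⟨le_rfl, hle⟩
    obtain ⟨q, hq⟩ := hmem (τ (k + 1)) ⟨hle, le_rfl⟩
    rw [S.lift_sub_eq_of_mem_cell (hf _ hlen) hG hle hmem hp hq]
    rw [hvert k hk.le] at hp
    rw [hvert (k + 1) hk] at hq
    obtain ⟨hp', hq'⟩ := H.vert_mem_V γ hk
    have hp0 : p ∈ S.V 0 := (S.wordMap_mem_V (w := w k)).1 (by rwa [hp, hlen, zero_add])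
    have hq0 : q ∈ S.V 0 := (S.wordMap_mem_V (w := w k)).1 (by rwa [hq, hlen, zero_add])
    rw [hval _ p hp0, hval _ q hq0, hp, hq]
    push_cast
    ring
  have hends : γ.vert γ.length = γ.vert 0 := by
    simp [GraphCycle.vert, GraphCycle.length]
  rw [← hτ0, ← hτ1, ← Finset.sum_range_sub (fun k => G (τ k)), Finset.sum_congr rfl hstep,
    Finset.sum_add_distrib, Finset.sum_range_sub (fun k => U (γ.vert k)), hends, sub_self, zero_add]
  push_cast
  rfl

/-- Two harmonic maps with the same jumps differ by a real function on `K`, whose boundary values are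
the difference of the boundary data. -/
theorem exists_real_difference [CompactSpace K] {M : ℕ} {A : List (Fin N) → K → ℤ}
    {U U' b b' : K → ℝ} {h h' : List (Fin N) → C(K, ℝ)} {f f' : C(K, UnitAddCircle)}
    (hU : ∀ x ∈ S.V 0, U x = b x) (hU' : ∀ x ∈ S.V 0, U' x = b' x)
    (hval : ∀ w, ∀ x ∈ S.V 0, h w x = U (wordMap S.F w x) + A w (wordMap S.F w x))
    (hval' : ∀ w, ∀ x ∈ S.V 0, h' w x = U' (wordMap S.F w x) + A w (wordMap S.F w x))
    (hf : ∀ w, w.length = M → ∀ x, f (wordMap S.F w x) = (h w x : UnitAddCircle))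
    (hf' : ∀ w, w.length = M → ∀ x, f' (wordMap S.F w x) = (h' w x : UnitAddCircle)) :
    ∃ g : C(K, ℝ), (∀ x, f' x = f x + (g x : UnitAddCircle)) ∧
      ∀ x ∈ S.V 0, g x = b' x - b x := by
  have hdiff : ∀ w, ∀ p ∈ S.V 0,
      (h' w - h w) p = U' (wordMap S.F w p) - U (wordMap S.F w p) := by
    intro w p hp
    rw [ContinuousMap.sub_apply, hval w p hp, hval' w p hp]
    ring
  obtain ⟨g, hg⟩ := S.exists_glue M (fun w => h' w - h w) (by
    intro w w' _ _ p hp q hq hpq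
    rw [hdiff w p hp, hdiff w' q hq, hpq])
  refine ⟨g, fun x => ?_, fun x hx => ?_⟩
  · obtain ⟨w, y, hw, rfl⟩ := S.exists_wordMap_eq M x
    rw [hf w hw, hf' w hw, hg w hw, ContinuousMap.sub_apply, ← AddCircle.coe_add]
    congr 1
    ring
  · obtain ⟨w, y, hw, rfl⟩ := S.exists_wordMap_eq M x
    have hy : y ∈ S.V 0 := (S.wordMap_mem_V (w := w)).1 (S.V_mono (Nat.zero_le _) hx)
    rw [hg w hw, hdiff w y hy, hU _ hx, hU' _ hx]

end HarmonicStructure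

/-- A cycle enters each of its vertices exactly once. -/
theorem GraphCycle.exists_vert_succ_eq {V : Type*} {G : SimpleGraph V} (γ : GraphCycle G) {x : V}
    (hx : x ∈ γ.verts) :
    ∃ l < γ.length, γ.vert (l + 1) = x ∧ ∀ k < γ.length, γ.vert (k + 1) = x → k = l := by
  obtain ⟨i, hi, hil⟩ := SimpleGraph.Walk.mem_support_iff_exists_getVert.1 hx
  have hpos : 0 < γ.walk.length := by
    have := γ.isCycle.three_le_length
    omega
  obtain ⟨l, hl, hlx⟩ : ∃ l < γ.length, γ.vert (l + 1) = x := by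
    rcases Nat.eq_zero_or_pos i with rfl | hi0
    · refine ⟨γ.walk.length - 1, by simp only [GraphCycle.length]; omega, ?_⟩
      rw [GraphCycle.vert, Nat.sub_add_cancel hpos, ← hi]
      simp
    · refine ⟨i - 1, by simp only [GraphCycle.length]; omega, ?_⟩
      rw [GraphCycle.vert, Nat.sub_add_cancel hi0, hi]
  refine ⟨l, hl, hlx, fun k hk hkx => ?_⟩
  have := γ.isCycle.getVert_injOn (x₁ := k + 1) (x₂ := l + 1) ⟨by omega, hk⟩ ⟨by omega, hl⟩
    (hkx.trans hlx.symm)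
  omega

/-! ### Choice of the jumps and of the boundary values -/

theorem theorem7p2 {K : Type*} [MetricSpace K] [CompactSpace K] [ConnectedSpace K] {N : ℕ}
    (S : PCFFractal K N) (H : HarmonicStructure S) (m n : ℕ)
    -- the basis of the cycle space of `Γ_m`, the embedding into `Γ_{m+1}` and the cut points
    (γ : Fin n → GraphCycle (H.graph m)) (hγ : IsCycleBasis γ)
    (ι : Fin n → GraphCycle (H.graph (m + 1))) (ξ : Fin n → K)
    (h_extend : ∀ i, (γ i).verts ⊆ (ι i).verts)
    (h_embed : ∀ i j, j ≠ i → (ι i).verts ∩ (ι j).verts = (γ i).verts ∩ (γ j).verts)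
    (h_cut : ∀ i, ξ i ∈ (ι i).verts ∧ ∀ j, j ≠ i → ξ i ∉ (ι j).verts)
    -- the loops in `K` that correspond to the cycles
    (c : Fin n → C(UnitAddCircle, K)) (w : Fin n → ℕ → List (Fin N))
    (h_trace : ∀ i, H.Traces (c i) (ι i) (w i))
    -- the two itineraries of a cut point: the cycle passes from one cell to another one there
    (h_itineraries : ∀ i, ∀ k < (ι i).length, ∀ l < (ι i).length,
      (ι i).vert (k + 1) = ξ i → (ι i).vert l = ξ i → w i k ≠ w i l)
    -- the loop through the boundary `V₀ = {v 0, …, v ℓ}`, which is visited in this order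
    (γ₀ : GraphCycle (H.graph m)) (hγ₀ : S.V 0 ⊆ γ₀.verts)
    (c₀ : C(UnitAddCircle, K)) (hc₀ : γ₀.verts ⊆ Set.range c₀)
    (ℓ : ℕ) (v : Fin (ℓ + 1) → K) (hv : Function.Injective v) (hv_range : Set.range v = S.V 0)
    (τ : Fin (ℓ + 1) → ℝ) (hτ : StrictMono τ) (hτ_last : τ (Fin.last ℓ) < τ 0 + 1)
    (hτ_v : ∀ k, c₀ (τ k : UnitAddCircle) = v k)
    -- the degree and the boundary data
    (ρ : Fin n → ℤ) (δ : Fin ℓ → ℝ) :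
    ∃ f : C(K, UnitAddCircle), H.IsHarmonicMap f ∧
      (∀ i, HasDegree (f.comp (c i)) (ρ i)) ∧
      ∃ ρ₀ : ℤ, HasDegree (f.comp c₀) ρ₀ ∧
        ∃ G : ℝ → ℝ, IsLift (f.comp c₀) G ∧
          (∀ k : Fin ℓ, G (τ k.succ) - G (τ k.castSucc) = δ k) ∧
          G (τ 0 + 1) - G (τ (Fin.last ℓ)) = ρ₀ - ∑ k, δ k := by
  classical
  choose l hl hlξ hl_unique using fun i => (ι i).exists_vert_succ_eq (h_cut i).1
  let A : List (Fin N) → K → ℤ := fun u y => ∑ i, if y = ξ i ∧ u = w i (l i) then ρ i else 0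
  have hA : ∀ i u, ∀ y ∈ (ι i).verts, A u y = if y = ξ i ∧ u = w i (l i) then ρ i else 0 := by
    intro i u y hy
    refine Finset.sum_eq_single i (fun j _ hji => if_neg ?_) (by simp)
    rintro ⟨rfl, -⟩
    exact (h_cut j).2 i (Ne.symm hji) hy
  have hvert : ∀ i k, (ι i).vert k ∈ (ι i).verts := fun i k =>
    (ι i).walk.getVert_mem_support k
  -- the lift jumps by `ρ i` when `ι i` enters the cut point, and it leaves it through another cell
  have hsum : ∀ i, ∑ k ∈ Finset.range (ι i).length,
      (A (w i k) ((ι i).vert (k + 1)) - A (w i k) ((ι i).vert k)) = ρ i := by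
    intro i
    rw [Finset.sum_eq_single (l i)]
    · rw [hA i _ _ (hvert i _), hA i _ _ (hvert i _), if_pos ⟨hlξ i, rfl⟩, if_neg, sub_zero]
      rintro ⟨h, -⟩
      exact h_itineraries i (l i) (hl i) (l i) (hl i) (hlξ i) h rfl
    · intro k hk hkl
      rw [Finset.mem_range] at hk
      rw [hA i _ _ (hvert i _), hA i _ _ (hvert i _), if_neg, if_neg, sub_zero]
      · rintro ⟨h, h'⟩
        exact h_itineraries i (l i) (hl i) k hk (hlξ i) h h'.symm
      · rintro ⟨h, -⟩
        exact hkl (hl_unique i k hk h)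
    · intro h
      exact absurd (Finset.mem_range.2 (hl i)) h
  obtain ⟨U₀, h₀, f₀, hU₀, hval₀, hf₀, -⟩ := H.exists_harmonicMap_of_jumps (m + 1) A 0
  obtain ⟨G₀, hG₀⟩ := exists_isLift (f₀.comp c₀)
  -- the prescribed values of the lift at the parameters of the boundary points
  let D : Fin (ℓ + 1) → ℝ := Fin.induction 0 fun k x => x + δ k
  have hD : ∀ k : Fin ℓ, D k.succ - D k.castSucc = δ k := fun k => by
    simp [D, Fin.induction_succ]
  let b : K → ℝ := Function.extend v (fun k => D k - G₀ (τ k)) 0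
  obtain ⟨U, h, f, hU, hval, hf, hharm⟩ := H.exists_harmonicMap_of_jumps (m + 1) A b
  obtain ⟨g, hg, hgb⟩ := HarmonicStructure.exists_real_difference hU₀ hU hval₀ hval hf₀ hf
  refine ⟨f, hharm, fun i => ?_, ?_⟩
  · obtain ⟨G, hG⟩ := exists_isLift (f.comp (c i))
    exact ⟨G, hG, by rw [H.lift_sub_eq_sum_jumps hval hf (h_trace i) hG, hsum]⟩
  let G : ℝ → ℝ := fun t => G₀ t + g (c₀ (t : UnitAddCircle))
  have hG : IsLift (f.comp c₀) G := by
    refine ⟨hG₀.1.add (g.continuous.comp (c₀.continuous.comp continuous_coe_unitAddCircle)),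
      fun t => ?_⟩
    rw [ContinuousMap.comp_apply, hg, AddCircle.coe_add, hG₀.2]
    rfl
  have hGτ : ∀ k, G (τ k) = D k := by
    intro k
    have hvk : v k ∈ S.V 0 := hv_range ▸ Set.mem_range_self k
    simp only [G, hτ_v, hgb _ hvk, b, hv.extend_apply, Pi.zero_apply]
    ring
  obtain ⟨ρ₀, hρ₀, hper⟩ := hG.exists_degree
  refine ⟨ρ₀, hρ₀, G, hG, fun k => by rw [hGτ, hGτ, hD], ?_⟩
  have htel : ∑ k, δ k = D (Fin.last ℓ) - D 0 := by
    have h₁ := Fin.sum_univ_succ D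
    have h₂ := Fin.sum_univ_castSucc D
    simp only [← hD, Finset.sum_sub_distrib]
    linarith
  have := hper (τ 0)
  rw [hGτ] at this
  rw [htel, hGτ]
  linarith
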